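/- Let $N,n\ge 0$ be integers, let $V=\mathbb C^N$ with standard basis $v_1,\dots,v_N$, and write $\mathbb C[z]=\mathbb C[z_1,\dots,z_n]$. Let $S_n$ act on $\mathcal V=V^{\otimes n}\otimes\mathbb C[z]$ by permuting tensor factors and variables simultaneously, $$\sigma\bigl(u_1\otimes\dots\otimes u_n\otimes p(z_1,\dots,z_n)\bigr)=u_{\sigma^{-1}(1)}\otimes\dots\otimes u_{\sigma^{-1}(n)}\otimes p(z_{\sigma(1)},\dots,z_{\sigma(n)}),$$ and let $\mathcal V^+=\{x:\sigma x=x\ \forall\sigma\}$ and $\mathcal V^-=\{x:\sigma x=\operatorname{sgn}(\sigma)x\ \forall\sigma\}$ be the subspaces of invariants and antiinvariants; they are modules over the ring $\mathbb C[z]^+$ of symmetric polynomials. Put $D=\prod_{1\le i<j\le n}(z_j-z_i)$ and let $\frac1D\mathcal V^-$ be the $\mathbb C[z]^+$-module of $V^{\otimes n}$-valued rational functions $\frac1D x$ with $x\in\mathcal V^-$. Let $J\subset\mathbb C[z]^+$ be the ideal generated by the elementary symmetric polynomials $\sigma_1(z),\dots,\sigma_n(z)$, and put $J^+=J\,\mathcal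 V^+$ and $J^-=\frac1D J\,\mathcal V^-$. The Shapovalov form is the bilinear form on $V^{\otimes n}$ for which the basis $\{v_{i_1}\otimes\dots\otimes v_{i_n}\}$ is orthonormal, extended $\mathbb C(z)$-bilinearly to $V^{\otimes n}$-valued rational functions. **Theorem.** The Shapovalov form restricts to a $\mathbb C[z]^+$-bilinear map $\mathcal S_{+-}:\mathcal V^+\times\frac1D\mathcal V^-\to\mathbb C[z]^+$, and reduction of $\mathcal S_{+-}$ modulo $J$ gives a well-defined $\mathbb C$-bilinear pairing $$\mathcal V^+/J^+\ \otimes\ \tfrac1D\mathcal V^- /J^-\ \longrightarrow\ \mathbb C[z]^+/J=\mathbb C,$$ which is nondegenerate: no nonzero element of either space is orthogonal to the whole of the other space. -/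

import Mathlib

open scoped TensorProduct

noncomputable section

namespace ShapovalovPairing

/-- The polynomial ring `ℂ[z] = ℂ[z_1, …, z_n]`. -/
abbrev Poly (n : ℕ) : Type := MvPolynomial (Fin n) ℂ

/-- The ring `ℂ[z]⁺` of symmetric polynomials in `z_1, …, z_n`. -/
def SymPoly (n : ℕ) : Type := MvPolynomial.symmetricSubalgebra (Fin n) ℂ

instance (n : ℕ) : CommRing (SymPoly n) :=
  inferInstanceAs (CommRing (MvPolynomial.symmetricSubalgebra (Fin n) ℂ))

instance (n : ℕ) : Algebra ℂ (SymPoly n) :=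
  inferInstanceAs (Algebra ℂ (MvPolynomial.symmetricSubalgebra (Fin n) ℂ))

/-- `ℂ[z]` as an algebra over its subring `ℂ[z]⁺`, through the inclusion. -/
instance (n : ℕ) : Algebra (SymPoly n) (Poly n) :=
  inferInstanceAs (Algebra (MvPolynomial.symmetricSubalgebra (Fin n) ℂ) (Poly n))

instance (n : ℕ) : IsScalarTower ℂ (SymPoly n) (Poly n) :=
  inferInstanceAs (IsScalarTower ℂ (MvPolynomial.symmetricSubalgebra (Fin n) ℂ) (Poly n))

/-- The field `ℂ(z)` of rational functions in `z_1, …, z_n`. -/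
abbrev RatFun (n : ℕ) : Type := FractionRing (Poly n)

/-- The tensor power `V^{⊗n}` of the vector space `V = ℂ^N`. -/
abbrev TensorPow (N n : ℕ) : Type := ⨂[ℂ] _ : Fin n, (Fin N → ℂ)

/-- The basis `v_{i_1} ⊗ … ⊗ v_{i_n}` of `V^{⊗n}`, indexed by the sequences `(i_1, …, i_n)`. -/
def tensorBasis (N n : ℕ) : Module.Basis (Fin n → Fin N) ℂ (TensorPow N n) :=
  Basis.piTensorProduct fun _ : Fin n => Pi.basisFun ℂ (Fin N)

/-- The Shapovalov form: the bilinear form on `V^{⊗n}` for which the basis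
`v_{i_1} ⊗ … ⊗ v_{i_n}` is orthonormal (its Gram matrix is the identity matrix). -/
def shapovalov (N n : ℕ) : LinearMap.BilinForm ℂ (TensorPow N n) :=
  Matrix.toBilin (tensorBasis N n) 1

/-- The space `V^{⊗n} ⊗ ℂ[z]` of polynomials with coefficients in `V^{⊗n}`
(the factor `ℂ[z]` is written on the left, as Mathlib does for an extension of scalars). -/
def PolyV (N n : ℕ) : Type := Poly n ⊗[ℂ] TensorPow N n

instance (N n : ℕ) : AddCommGroup (PolyV N n) :=
  inferInstanceAs (AddCommGroup (Poly n ⊗[ℂ] TensorPow N n))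

instance (N n : ℕ) : Module ℂ (PolyV N n) :=
  inferInstanceAs (Module ℂ (Poly n ⊗[ℂ] TensorPow N n))

instance (N n : ℕ) : Module (Poly n) (PolyV N n) :=
  inferInstanceAs (Module (Poly n) (Poly n ⊗[ℂ] TensorPow N n))

instance (N n : ℕ) : IsScalarTower ℂ (Poly n) (PolyV N n) :=
  inferInstanceAs (IsScalarTower ℂ (Poly n) (Poly n ⊗[ℂ] TensorPow N n))

/-- Multiplication of `V^{⊗n}`-valued polynomials by symmetric polynomials. -/
instance (N n : ℕ) : Module (SymPoly n) (PolyV N n) :=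
  Module.compHom _ (algebraMap (SymPoly n) (Poly n))

instance (N n : ℕ) : IsScalarTower (SymPoly n) (Poly n) (PolyV N n) :=
  IsScalarTower.of_algebraMap_smul fun _ _ => rfl

instance (N n : ℕ) : IsScalarTower ℂ (SymPoly n) (PolyV N n) :=
  IsScalarTower.to₁₂₄ ℂ (SymPoly n) (Poly n) (PolyV N n)

/-- The space `V^{⊗n} ⊗ ℂ(z)` of `V^{⊗n}`-valued rational functions. -/
def RatV (N n : ℕ) : Type := RatFun n ⊗[ℂ] TensorPow N n

instance (N n : ℕ) : AddCommGroup (RatV N n) :=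
  inferInstanceAs (AddCommGroup (RatFun n ⊗[ℂ] TensorPow N n))

instance (N n : ℕ) : Module ℂ (RatV N n) :=
  inferInstanceAs (Module ℂ (RatFun n ⊗[ℂ] TensorPow N n))

instance (N n : ℕ) : Module (RatFun n) (RatV N n) :=
  inferInstanceAs (Module (RatFun n) (RatFun n ⊗[ℂ] TensorPow N n))

instance (N n : ℕ) : IsScalarTower ℂ (RatFun n) (RatV N n) :=
  inferInstanceAs (IsScalarTower ℂ (RatFun n) (RatFun n ⊗[ℂ] TensorPow N n))

/-- Multiplication of `V^{⊗n}`-valued rational functions by symmetric polynomials. -/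
instance (N n : ℕ) : Module (SymPoly n) (RatV N n) :=
  Module.compHom _ (algebraMap (SymPoly n) (RatFun n))

instance (N n : ℕ) : IsScalarTower (SymPoly n) (RatFun n) (RatV N n) :=
  IsScalarTower.of_algebraMap_smul fun _ _ => rfl

instance (n : ℕ) : IsScalarTower ℂ (SymPoly n) (RatFun n) :=
  inferInstance

instance (N n : ℕ) : IsScalarTower ℂ (SymPoly n) (RatV N n) :=
  IsScalarTower.to₁₂₄ ℂ (SymPoly n) (RatFun n) (RatV N n)

/-- The action of a permutation `σ`, permuting the tensor factors and the variables
simultaneously: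
`v_1 ⊗ … ⊗ v_n ⊗ p(z_1, …, z_n) ↦ v_{σ⁻¹ 1} ⊗ … ⊗ v_{σ⁻¹ n} ⊗ p(z_{σ 1}, …, z_{σ n})`. -/
def permAct (N n : ℕ) (σ : Equiv.Perm (Fin n)) : PolyV N n →ₗ[ℂ] PolyV N n :=
  TensorProduct.map (MvPolynomial.rename σ).toLinearMap
    (PiTensorProduct.reindex ℂ (fun _ : Fin n => (Fin N → ℂ)) σ).toLinearMap

theorem tensorMap_smul {A B T T' : Type*} [CommRing A] [Algebra ℂ A] [CommRing B] [Algebra ℂ B]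
    [AddCommGroup T] [Module ℂ T] [AddCommGroup T'] [Module ℂ T'] (f : A →ₗ[ℂ] B) (g : T →ₗ[ℂ] T')
    (q : A) (q' : B) (h : ∀ r, f (q * r) = q' * f r) (x : A ⊗[ℂ] T) :
    TensorProduct.map f g (q • x) = q' • TensorProduct.map f g x := by
  induction x using TensorProduct.induction_on with
  | zero => simp
  | tmul r t => simp [TensorProduct.smul_tmul', h]
  | add a b ha hb => rw [smul_add, map_add, map_add, smul_add, ha, hb]

theorem permAct_smul (N n : ℕ) (σ : Equiv.Perm (Fin n)) (p : SymPoly n) (x : PolyV N n) :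
    permAct N n σ (p • x) = p • permAct N n σ x := by
  have hp : MvPolynomial.rename σ (algebraMap (SymPoly n) (Poly n) p) =
      algebraMap (SymPoly n) (Poly n) p := p.2 σ
  refine tensorMap_smul _ _ (algebraMap (SymPoly n) (Poly n) p) _ (fun r => ?_) x
  rw [AlgHom.toLinearMap_apply, AlgHom.toLinearMap_apply, map_mul, hp]
  rfl

/-- The `ℂ[z]⁺`-module of `S_n`-invariant elements. -/
def invariants (N n : ℕ) : Submodule (SymPoly n) (PolyV N n) where
  carrier := {x | ∀ σ : Equiv.Perm (Fin n), permAct N n σ x = x}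
  add_mem' := by
    intro a b ha hb σ
    rw [map_add, ha σ, hb σ]
  zero_mem' := by
    intro σ
    rw [map_zero]
  smul_mem' := by
    intro p x hx σ
    rw [permAct_smul, hx σ]

/-- The `ℂ[z]⁺`-module of `S_n`-antiinvariant elements. -/
def antiinvariants (N n : ℕ) : Submodule (SymPoly n) (PolyV N n) where
  carrier := {x | ∀ σ : Equiv.Perm (Fin n),
    permAct N n σ x = ((Equiv.Perm.sign σ : ℤ) : ℂ) • x}
  add_mem' := by
    intro a b ha hb σ
    rw [map_add, ha σ, hb σ, smul_add]
  zero_mem' := by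
    intro σ
    rw [map_zero, smul_zero]
  smul_mem' := by
    intro p x hx σ
    rw [permAct_smul, hx σ, smul_algebra_smul_comm]

/-- The Vandermonde polynomial `D = ∏_{i < j} (z_j - z_i)`. -/
def vandermondePoly (n : ℕ) : Poly n :=
  ∏ i : Fin n, ∏ j ∈ Finset.Ioi i, (MvPolynomial.X j - MvPolynomial.X i)

/-- The inclusion of `V^{⊗n}`-valued polynomials into `V^{⊗n}`-valued rational functions. -/
def toRatV (N n : ℕ) : PolyV N n →ₗ[ℂ] RatV N n :=
  TensorProduct.map ((Algebra.linearMap (Poly n) (RatFun n)).restrictScalars ℂ) LinearMap.id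

theorem toRatV_smul (N n : ℕ) (p : SymPoly n) (x : PolyV N n) :
    toRatV N n (p • x) = p • toRatV N n x := by
  refine tensorMap_smul _ _ (algebraMap (SymPoly n) (Poly n) p)
    (algebraMap (SymPoly n) (RatFun n) p) (fun r => ?_) x
  rw [IsScalarTower.algebraMap_apply (SymPoly n) (Poly n) (RatFun n)]
  exact map_mul (algebraMap (Poly n) (RatFun n)) _ _

/-- The `ℂ[z]⁺`-module `(1/D) 𝒱⁻` of the rational functions `(1/D) x` with `x` antiinvariant. -/
def divAntiinvariants (N n : ℕ) : Submodule (SymPoly n) (RatV N n) where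
  carrier := {w | ∃ x ∈ antiinvariants N n,
    w = (algebraMap (Poly n) (RatFun n) (vandermondePoly n))⁻¹ • toRatV N n x}
  add_mem' := by
    rintro _ _ ⟨a, ha, rfl⟩ ⟨b, hb, rfl⟩
    exact ⟨a + b, add_mem ha hb, by rw [map_add, smul_add]⟩
  zero_mem' := ⟨0, zero_mem _, by rw [map_zero, smul_zero]⟩
  smul_mem' := by
    rintro p _ ⟨a, ha, rfl⟩
    refine ⟨p • a, Submodule.smul_mem _ p ha, ?_⟩
    rw [toRatV_smul, ← algebraMap_smul (RatFun n) p (toRatV N n a),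
      ← algebraMap_smul (RatFun n) p, smul_smul, smul_smul, mul_comm]

/-- The Shapovalov form extended `ℂ(z)`-bilinearly to `V^{⊗n}`-valued rational functions. -/
def shapovalovRat (N n : ℕ) : LinearMap.BilinForm (RatFun n) (RatV N n) :=
  LinearMap.BilinForm.baseChange (RatFun n) (shapovalov N n)

/-- The elementary symmetric polynomial `σ_s(z)` as an element of `ℂ[z]⁺`. -/
def elemSym (n s : ℕ) : SymPoly n :=
  ⟨MvPolynomial.esymm (Fin n) ℂ s, MvPolynomial.esymm_isSymmetric (Fin n) ℂ s⟩

/-- The ideal `J` of `ℂ[z]⁺` generated by `σ_1(z), …, σ_n(z)`. -/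
def idealJ (n : ℕ) : Ideal (SymPoly n) :=
  Ideal.span (elemSym n '' Set.Icc 1 n)

/-- The submodule `J⁺ = J 𝒱⁺` of `𝒱⁺`. -/
def Jplus (N n : ℕ) : Submodule (SymPoly n) (invariants N n) :=
  idealJ n • ⊤

/-- The submodule `J⁻ = (1/D) J 𝒱⁻` of `(1/D) 𝒱⁻`. -/
def Jminus (N n : ℕ) : Submodule (SymPoly n) (divAntiinvariants N n) :=
  idealJ n • ⊤

end ShapovalovPairing

end

open ShapovalovPairing

/-! For `x` invariant and `y` antiinvariant, the form `⟨x, y⟩` is an alternating polynomial, hence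
`D` times a symmetric one. This gives `𝒮₊₋`.

Nondegeneracy rests on the kernel `K(z, w) = ∏_{i<j} (z_j - w_i)`: it equals `D` at `w = z` and
vanishes at `w = σz` for `σ ≠ 1`. Expanding `K` in monomials of `w` turns `D f = ∑_σ sgn(σ) σ(f)
K(z, σz)` into a combination, over `ℂ[z]`, of antisymmetrizations of `f z^m`
(`vandermondePoly_mul_eq_sum`). So if every antisymmetrization of a multiple of `f` lies in `D J`,
then `f ∈ J ℂ[z]` (`mem_idealJ_smul_top`).

Let `x` be orthogonal modulo `J` to the other side. Pairing `x` with the twisted sum of `g e_I`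
antisymmetrizes `x_I g`, so every coordinate `x_I` lies in `J ℂ[z]` and `x ∈ J 𝒱`. Averaging over
`S_n` is `ℂ[z]⁺`-linear and fixes `x`, so `x` lies in `J` times its own isotypic part. Sign
characters `χ`, `ψ` with `χψ = sgn` treat invariants and antiinvariants at once. -/

noncomputable section

namespace ShapovalovPairing
open MvPolynomial

/-! ### Alternating polynomials and their divisibility by `D` -/

/-- The signed sum `∑ sgn(σ) σ(p)` over all permutations of the variables. -/
def antisymm (n : ℕ) : Poly n →ₗ[ℂ] Poly n :=
  ∑ σ : Equiv.Perm (Fin n), ((Equiv.Perm.sign σ : ℤ) : ℂ) • (rename σ).toLinearMap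

theorem antisymm_apply (n : ℕ) (p : Poly n) :
    antisymm n p = ∑ σ : Equiv.Perm (Fin n), ((Equiv.Perm.sign σ : ℤ) : ℂ) • rename σ p := by
  simp [antisymm]

/-- Antiinvariance of a scalar polynomial. -/
def IsAlternatingPoly {n : ℕ} (p : Poly n) : Prop :=
  ∀ σ : Equiv.Perm (Fin n), rename σ p = ((Equiv.Perm.sign σ : ℤ) : ℂ) • p

theorem units_smul_units_smul {M : Type*} [AddCommGroup M] [Module ℂ M] (u : ℤˣ) (x : M) :
    ((u : ℤ) : ℂ) • ((u : ℤ) : ℂ) • x = x := by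
  rw [smul_smul, ← Int.cast_mul, ← Units.val_mul, Int.units_mul_self]
  simp

/-- Modulo `X j - X i` the transposition of `i` and `j` acts trivially, yet it negates `p`; hence
`2p = 0` in the quotient. -/
theorem IsAlternatingPoly.X_sub_X_dvd {n : ℕ} {p : Poly n} (hp : IsAlternatingPoly p)
    {i j : Fin n} (hij : i ≠ j) : (X j - X i : Poly n) ∣ p := by
  rw [← Ideal.mem_span_singleton, ← Ideal.Quotient.eq_zero_iff_mem]
  set I : Ideal (Poly n) := Ideal.span {X j - X i}
  have hX : Ideal.Quotient.mk I (X j) = Ideal.Quotient.mk I (X i) :=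
    Ideal.Quotient.eq.mpr (Ideal.mem_span_singleton_self _)
  have h := congrArg (Ideal.Quotient.mkₐ ℂ I) (hp (Equiv.swap i j))
  have hcomp : (Ideal.Quotient.mkₐ ℂ I).comp (rename (Equiv.swap i j)) =
      Ideal.Quotient.mkₐ ℂ I := by
    refine MvPolynomial.algHom_ext fun k => ?_
    simp only [AlgHom.comp_apply, rename_X, Ideal.Quotient.mkₐ_eq_mk]
    rcases eq_or_ne k i with rfl | hki
    · rw [Equiv.swap_apply_left, hX]
    rcases eq_or_ne k j with rfl | hkj
    · rw [Equiv.swap_apply_right, hX]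
    · rw [Equiv.swap_apply_of_ne_of_ne hki hkj]
  rw [← AlgHom.comp_apply, hcomp, map_smul, Equiv.Perm.sign_swap hij] at h
  simp only [Units.val_neg, Units.val_one, Int.cast_neg, Int.cast_one, neg_smul, one_smul] at h
  have h2 : (2 : ℂ) • Ideal.Quotient.mkₐ ℂ I p = 0 := by
    rw [two_smul]
    nth_rewrite 1 [h]
    exact neg_add_cancel _
  exact (smul_eq_zero_iff_right two_ne_zero).mp h2

theorem irreducible_X_sub_X {n : ℕ} {i j : Fin n} (hij : i ≠ j) :
    Irreducible (X j - X i : Poly n) := by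
  classical
  have hc : coeff (Finsupp.single j 1) (X j - X i : Poly n) = 1 := by
    simp [coeff_X, Finsupp.single_left_inj, hij]
  refine irreducible_of_totalDegree_eq_one (le_antisymm ?_ ?_) fun x hx => ?_
  · exact (totalDegree_sub _ _).trans (by simp)
  · have := le_totalDegree (p := (X j - X i : Poly n)) (s := Finsupp.single j 1)
      (by rw [mem_support_iff, hc]; exact one_ne_zero)
    simpa using this
  · have := hx (Finsupp.single j 1)
    rw [hc] at this
    exact isUnit_of_dvd_one this

/-- Otherwise one irreducible form divides the other, so `v a = v b` forces `v c = v d` at every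
point `v`. The indicator of an index in `{c, d}` outside `{a, b}` violates this. -/
theorem isRelPrime_X_sub_X {n : ℕ} {a b c d : Fin n} (hab : a < b) (hcd : c < d)
    (h : ¬ (a = c ∧ b = d)) : IsRelPrime (X b - X a : Poly n) (X d - X c) := by
  classical
  rw [(irreducible_X_sub_X hab.ne).isRelPrime_iff_not_dvd]
  intro hdvd
  have key : ∀ v : Fin n → ℂ, v a = v b → v c = v d := fun v hv => by
    have := map_dvd (eval v) hdvd
    simp only [map_sub, eval_X, hv, sub_self, zero_dvd_iff] at this
    exact (sub_eq_zero.mp this).symm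
  by_cases hc : a = c ∨ b = c
  · by_cases hd : a = d ∨ b = d
    -- Here `{c, d} ⊆ {a, b}`, and the orderings `a < b`, `c < d` make the pairs equal.
    · omega
    · push Not at hd
      have := key (Pi.single d 1) (by simp [hd.1, hd.2])
      simp [hcd.ne] at this
  · push Not at hc
    have := key (Pi.single c 1) (by simp [hc.1, hc.2])
    simp [hcd.ne'] at this

theorem vandermondePoly_eq_prod_sigma (n : ℕ) : vandermondePoly n =
    ∏ q ∈ Finset.univ.sigma fun i : Fin n => Finset.Ioi i, (X q.2 - X q.1) := by
  rw [vandermondePoly, Finset.prod_sigma]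

theorem IsAlternatingPoly.vandermondePoly_dvd {n : ℕ} {p : Poly n} (hp : IsAlternatingPoly p) :
    vandermondePoly n ∣ p := by
  rw [vandermondePoly_eq_prod_sigma]
  refine Finset.prod_dvd_of_isRelPrime ?_ ?_
  · rintro ⟨a, b⟩ hab ⟨c, d⟩ hcd hne
    simp only [Finset.coe_sigma, Set.mem_sigma_iff, Finset.mem_coe, Finset.mem_Ioi] at hab hcd
    refine isRelPrime_X_sub_X hab.2 hcd.2 ?_
    rintro ⟨rfl, rfl⟩
    exact hne rfl
  · rintro ⟨a, b⟩ hab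
    simp only [Finset.mem_sigma, Finset.mem_Ioi] at hab
    exact hp.X_sub_X_dvd hab.2.ne

theorem vandermondePoly_ne_zero (n : ℕ) : vandermondePoly n ≠ 0 := by
  rw [vandermondePoly_eq_prod_sigma, Finset.prod_ne_zero_iff]
  rintro ⟨a, b⟩ hab
  simp only [Finset.mem_sigma, Finset.mem_Ioi] at hab
  exact (irreducible_X_sub_X hab.2.ne).ne_zero

/-! ### The reproducing kernel and division by `D` -/

/-- The kernel `∏_{i < j} (z_j - w_i)`, a polynomial in `w` with coefficients in `ℂ[z]`. -/
def reproducingKernel (n : ℕ) : MvPolynomial (Fin n) (Poly n) :=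
  ∏ q ∈ Finset.univ.sigma fun i : Fin n => Finset.Ioi i, (C (X q.2) - X q.1)

theorem eval_reproducingKernel_one (n : ℕ) :
    eval (fun i => (X i : Poly n)) (reproducingKernel n) = vandermondePoly n := by
  rw [vandermondePoly_eq_prod_sigma, reproducingKernel, map_prod]
  simp

/-- A permutation other than the identity moves some `i` up, and then the factor indexed by `(i, σ
i)` is zero. -/
theorem eval_reproducingKernel_perm {n : ℕ} {σ : Equiv.Perm (Fin n)} (hσ : σ ≠ 1) :
    eval (fun i => (X (σ i) : Poly n)) (reproducingKernel n) = 0 := by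
  obtain ⟨i, hi⟩ : ∃ i, i < σ i := by
    by_contra! h
    refine hσ (Equiv.ext fun i => ?_)
    -- If `σ i < i`, then `σ i` is already fixed, so `σ (σ i) = σ i` contradicts injectivity.
    induction i using WellFoundedLT.induction with
    | ind i ih =>
      refine (h i).eq_or_lt.elim id fun hlt => ?_
      exact absurd (σ.injective (ih _ hlt)) hlt.ne
  rw [reproducingKernel, map_prod]
  exact Finset.prod_eq_zero (i := ⟨i, σ i⟩) (by simpa using hi) (by simp)

/-- The reproducing property: a multiple of `D` by any polynomial `f` is a combination of the
antisymmetrizations of `f z^m`. -/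
theorem vandermondePoly_mul_eq_sum (n : ℕ) (f : Poly n) :
    vandermondePoly n * f = ∑ m ∈ (reproducingKernel n).support,
      coeff m (reproducingKernel n) * antisymm n (f * monomial m 1) := by
  have h : ∀ σ : Equiv.Perm (Fin n), eval (fun i => (X (σ i) : Poly n)) (reproducingKernel n) =
      ∑ m ∈ (reproducingKernel n).support,
        coeff m (reproducingKernel n) * rename σ (monomial m (1 : ℂ)) := fun σ => by
    rw [eval_eq']
    refine Finset.sum_congr rfl fun m _ => ?_
    rw [monomial_eq, C_1, one_mul, Finsupp.prod_fintype _ _ (by simp), map_prod]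
    simp
  simp_rw [antisymm_apply, Finset.mul_sum]
  -- After the exchange, the inner sum for `σ` is `sgn(σ) σ(f) K(z, σz)`, so only `σ = 1` survives.
  rw [Finset.sum_comm, Finset.sum_eq_single 1]
  · rw [← eval_reproducingKernel_one]
    have := h 1
    simp only [Equiv.Perm.one_apply] at this
    rw [this, Finset.sum_mul]
    refine Finset.sum_congr rfl fun m _ => ?_
    simp only [Equiv.Perm.sign_one, Units.val_one, Int.cast_one, one_smul, Equiv.Perm.coe_one,
      rename_id, AlgHom.id_apply]
    ring
  · intro σ _ hσ
    have h0 := h σ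
    rw [eval_reproducingKernel_perm hσ] at h0
    rw [← smul_zero ((Equiv.Perm.sign σ : ℤ) : ℂ), ← mul_zero (rename σ f), h0, Finset.mul_sum,
      Finset.smul_sum]
    refine Finset.sum_congr rfl fun m _ => ?_
    rw [map_mul, mul_smul_comm]
    ring_nf
  · simp

/-- Renaming the variables permutes the rows of the Vandermonde matrix. -/
theorem rename_vandermondePoly {n : ℕ} (σ : Equiv.Perm (Fin n)) :
    rename σ (vandermondePoly n) = ((Equiv.Perm.sign σ : ℤ) : ℂ) • vandermondePoly n := by
  have h1 : vandermondePoly n = (Matrix.vandermonde (X : Fin n → Poly n)).det :=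
    (Matrix.det_vandermonde _).symm
  rw [h1, AlgHom.map_det]
  have : (rename σ).mapMatrix (Matrix.vandermonde (X : Fin n → Poly n)) =
      (Matrix.vandermonde (X : Fin n → Poly n)).submatrix σ id := by
    ext i j
    simp [Matrix.vandermonde_apply]
  rw [this, Matrix.det_permute]
  simp [Algebra.smul_def]

/-- The quotient of an antiinvariant polynomial by `D` is symmetric. -/
theorem IsAlternatingPoly.exists_symPoly {n : ℕ} {p : Poly n} (hp : IsAlternatingPoly p) :
    ∃ s : SymPoly n, p = vandermondePoly n * algebraMap (SymPoly n) (Poly n) s := by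
  obtain ⟨q, rfl⟩ := hp.vandermondePoly_dvd
  refine ⟨⟨q, fun σ => ?_⟩, rfl⟩
  have h := hp σ
  rw [map_mul, rename_vandermondePoly, smul_mul_assoc] at h
  have h' := congrArg (((Equiv.Perm.sign σ : ℤ) : ℂ) • ·) h
  simp only [units_smul_units_smul] at h'
  exact mul_left_cancel₀ (vandermondePoly_ne_zero n) h'

/-- If all antisymmetrizations of multiples of `f` lie in `D J`, then `f ∈ J ℂ[z]`. -/
theorem mem_idealJ_smul_top {n : ℕ} {f : Poly n}
    (hf : ∀ g : Poly n, ∃ s ∈ idealJ n,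
      antisymm n (f * g) = vandermondePoly n * algebraMap (SymPoly n) (Poly n) s) :
    f ∈ idealJ n • (⊤ : Submodule (SymPoly n) (Poly n)) := by
  choose s hs hs' using fun m => hf (monomial m 1)
  have : f = ∑ m ∈ (reproducingKernel n).support, s m • coeff m (reproducingKernel n) := by
    refine mul_left_cancel₀ (vandermondePoly_ne_zero n) ?_
    rw [vandermondePoly_mul_eq_sum, Finset.mul_sum]
    refine Finset.sum_congr rfl fun m _ => ?_
    rw [hs', Algebra.smul_def]
    ring
  rw [this]
  exact Submodule.sum_mem _ fun m _ => Submodule.smul_mem_smul (hs m) trivial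

/-! ### The residue field `ℂ[z]⁺ / J = ℂ` -/

/-- The constant term of a symmetric polynomial. -/
def constTerm (n : ℕ) : SymPoly n →ₐ[ℂ] ℂ :=
  (aeval (fun _ : Fin n => (0 : ℂ))).comp (symmetricSubalgebra (Fin n) ℂ).val

theorem idealJ_le_ker (n : ℕ) : idealJ n ≤ RingHom.ker (constTerm n) := by
  rw [idealJ, Ideal.span_le]
  rintro _ ⟨s, hs, rfl⟩
  change aeval (fun _ : Fin n => (0 : ℂ)) (esymm (Fin n) ℂ s) = 0
  rw [esymm, map_sum]
  refine Finset.sum_eq_zero fun t ht => ?_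
  rw [map_prod]
  obtain ⟨i, hi⟩ : t.Nonempty := by
    rw [← Finset.card_pos, (Finset.mem_powersetCard.mp ht).2]
    exact hs.1
  exact Finset.prod_eq_zero hi (by simp)

/-- Injectivity: the constant term kills `J`. Surjectivity: a symmetric polynomial is a polynomial
in the `σ_k`, of which only the constant survives modulo `J`. -/
theorem bijective_algebraMap_quotient_idealJ (n : ℕ) :
    Function.Bijective (algebraMap ℂ (SymPoly n ⧸ idealJ n)) := by
  constructor
  · intro a b hab
    rw [IsScalarTower.algebraMap_apply ℂ (SymPoly n) (SymPoly n ⧸ idealJ n),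
      IsScalarTower.algebraMap_apply ℂ (SymPoly n) (SymPoly n ⧸ idealJ n)] at hab
    have := idealJ_le_ker n (Ideal.Quotient.eq.mp hab)
    rw [RingHom.mem_ker, map_sub, AlgHom.commutes, AlgHom.commutes] at this
    exact sub_eq_zero.mp this
  · intro q
    obtain ⟨p, rfl⟩ := Ideal.Quotient.mk_surjective q
    obtain ⟨r, rfl⟩ := esymmAlgHom_surjective (σ := Fin n) (n := n) ℂ (by simp) p
    have hcomp : ((Ideal.Quotient.mkₐ ℂ (idealJ n)).comp
        (show MvPolynomial (Fin n) ℂ →ₐ[ℂ] SymPoly n from esymmAlgHom (Fin n) ℂ n)) =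
        (Algebra.ofId ℂ (SymPoly n ⧸ idealJ n)).comp (aeval fun _ => (0 : ℂ)) := by
      refine MvPolynomial.algHom_ext fun k => ?_
      simp only [AlgHom.comp_apply, aeval_X, map_zero]
      refine Ideal.Quotient.eq_zero_iff_mem.mpr ?_
      -- Variables are indexed from zero, so the one of index `k` goes to `σ_{k+1}`.
      have hk : esymmAlgHom (Fin n) ℂ n (X k) = elemSym n (k + 1) := aeval_X _ _
      exact hk ▸ Ideal.subset_span ⟨k + 1, ⟨by omega, by omega⟩, rfl⟩
    exact ⟨_, (DFunLike.congr_fun hcomp r).symm⟩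

/-! ### The Shapovalov form on polynomials and its equivariance -/

theorem reindex_tensorBasis {N n : ℕ} (σ : Equiv.Perm (Fin n)) (I : Fin n → Fin N) :
    PiTensorProduct.reindex ℂ (fun _ : Fin n => (Fin N → ℂ)) σ (tensorBasis N n I) =
      tensorBasis N n (I ∘ σ.symm) := by
  rw [tensorBasis, Basis.piTensorProduct_apply, Basis.piTensorProduct_apply]
  exact PiTensorProduct.reindex_tprod _ _

theorem shapovalov_tensorBasis {N n : ℕ} (I K : Fin n → Fin N) :
    shapovalov N n (tensorBasis N n I) (tensorBasis N n K) = if I = K then 1 else 0 := by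
  have h := congrFun₂
    (LinearMap.BilinForm.toMatrix_toBilin (tensorBasis N n) (1 : Matrix _ _ ℂ)) I K
  rwa [LinearMap.BilinForm.toMatrix_apply, Matrix.one_apply] at h

theorem shapovalov_comm {N n : ℕ} (s t : TensorPow N n) :
    shapovalov N n s t = shapovalov N n t s := by
  have : shapovalov N n = (shapovalov N n).flip :=
    (tensorBasis N n).ext fun I => (tensorBasis N n).ext fun K => by
      simp [shapovalov_tensorBasis, eq_comm]
  exact LinearMap.congr_fun₂ this s t

theorem shapovalov_reindex {N n : ℕ} (σ : Equiv.Perm (Fin n)) (s t : TensorPow N n) :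
    shapovalov N n (PiTensorProduct.reindex ℂ (fun _ : Fin n => (Fin N → ℂ)) σ s)
      (PiTensorProduct.reindex ℂ (fun _ : Fin n => (Fin N → ℂ)) σ t) = shapovalov N n s t := by
  let r : TensorPow N n →ₗ[ℂ] TensorPow N n :=
    (PiTensorProduct.reindex ℂ (fun _ : Fin n => (Fin N → ℂ)) σ).toLinearMap
  have hr (I : Fin n → Fin N) : r (tensorBasis N n I) = tensorBasis N n (I ∘ σ.symm) :=
    reindex_tensorBasis σ I
  have : (shapovalov N n).compl₁₂ r r = shapovalov N n :=
    (tensorBasis N n).ext fun I => (tensorBasis N n).ext fun K => by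
      simp only [LinearMap.compl₁₂_apply, hr, shapovalov_tensorBasis,
        (σ.symm.surjective.injective_comp_right).eq_iff]
  exact LinearMap.congr_fun₂ this s t

/-- The Shapovalov form extended `ℂ[z]`-bilinearly to `V^{⊗n}`-valued polynomials. -/
def shapovalovPoly (N n : ℕ) : LinearMap.BilinForm (Poly n) (PolyV N n) :=
  LinearMap.BilinForm.baseChange (Poly n) (shapovalov N n)

/-- The element `p ⊗ s` of `𝒱`. -/
def pureV {N n : ℕ} (p : Poly n) (s : TensorPow N n) : PolyV N n :=
  p ⊗ₜ[ℂ] s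

theorem polyV_induction {N n : ℕ} {P : PolyV N n → Prop} (tmul : ∀ p s, P (pureV p s))
    (add : ∀ a b, P a → P b → P (a + b)) (x : PolyV N n) : P x := by
  have h : pureV (0 : Poly n) (0 : TensorPow N n) = 0 := TensorProduct.zero_tmul _ _
  exact TensorProduct.induction_on x (h ▸ tmul 0 0) tmul add

theorem shapovalovPoly_pureV {N n : ℕ} (p q : Poly n) (s t : TensorPow N n) :
    shapovalovPoly N n (pureV p s) (pureV q t) = shapovalov N n s t • (p * q) :=
  rfl

theorem shapovalovPoly_smul_left {N n : ℕ} (c : ℂ) (x y : PolyV N n) :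
    shapovalovPoly N n (c • x) y = c • shapovalovPoly N n x y := by
  rw [← algebraMap_smul (Poly n) c x, map_smul, LinearMap.smul_apply, algebraMap_smul]

theorem shapovalovPoly_smul_right {N n : ℕ} (c : ℂ) (x y : PolyV N n) :
    shapovalovPoly N n x (c • y) = c • shapovalovPoly N n x y := by
  rw [← algebraMap_smul (Poly n) c y, map_smul, algebraMap_smul]

theorem shapovalovPoly_comm {N n : ℕ} (x y : PolyV N n) :
    shapovalovPoly N n x y = shapovalovPoly N n y x := by
  induction x using polyV_induction with
  | add a b ha hb => rw [map_add, map_add, LinearMap.add_apply, ha, hb]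
  | tmul p s =>
    induction y using polyV_induction with
    | add a b ha hb => rw [map_add, map_add, LinearMap.add_apply, ha, hb]
    | tmul q t => rw [shapovalovPoly_pureV, shapovalovPoly_pureV, shapovalov_comm, mul_comm]

theorem permAct_pureV {N n : ℕ} (σ : Equiv.Perm (Fin n)) (p : Poly n) (s : TensorPow N n) :
    permAct N n σ (pureV p s) = pureV (rename σ p)
      (PiTensorProduct.reindex ℂ (fun _ : Fin n => (Fin N → ℂ)) σ s) :=
  rfl

theorem shapovalovPoly_permAct {N n : ℕ} (σ : Equiv.Perm (Fin n)) (x y : PolyV N n) :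
    shapovalovPoly N n (permAct N n σ x) (permAct N n σ y) =
      rename σ (shapovalovPoly N n x y) := by
  induction x using polyV_induction with
  | add a b ha hb => simp only [map_add, LinearMap.add_apply, ha, hb]
  | tmul p s =>
    induction y using polyV_induction with
    | add a b ha hb => simp only [map_add, ha, hb]
    | tmul q t =>
      rw [permAct_pureV, permAct_pureV, shapovalovPoly_pureV, shapovalovPoly_pureV,
        shapovalov_reindex, map_smul, map_mul]

theorem shapovalovRat_toRatV {N n : ℕ} (x y : PolyV N n) :
    shapovalovRat N n (toRatV N n x) (toRatV N n y) =
      algebraMap (Poly n) (RatFun n) (shapovalovPoly N n x y) := by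
  induction x using polyV_induction with
  | add a b ha hb => simp only [map_add, LinearMap.add_apply, ha, hb]
  | tmul p s =>
    induction y using polyV_induction with
    | add a b ha hb => simp only [map_add, ha, hb]
    | tmul q t =>
      rw [shapovalovPoly_pureV]
      change shapovalov N n s t • (algebraMap (Poly n) (RatFun n) p *
        algebraMap (Poly n) (RatFun n) q) = _
      rw [← map_mul, ← IsScalarTower.coe_toAlgHom' ℂ (Poly n) (RatFun n), map_smul]

/-- The basis `v_{i_1} ⊗ … ⊗ v_{i_n}` of the `ℂ[z]`-module of `V^{⊗n}`-valued polynomials. -/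
def polyBasis (N n : ℕ) : Module.Basis (Fin n → Fin N) (Poly n) (PolyV N n) :=
  Algebra.TensorProduct.basis (Poly n) (tensorBasis N n)

/-- By orthonormality; this reduces membership in `J 𝒱` to scalar polynomials. -/
theorem shapovalovPoly_polyBasis {N n : ℕ} (x : PolyV N n) (I : Fin n → Fin N) :
    shapovalovPoly N n x (polyBasis N n I) = (polyBasis N n).repr x I := by
  have hb (K : Fin n → Fin N) : polyBasis N n K = (1 : Poly n) ⊗ₜ[ℂ] tensorBasis N n K :=
    Algebra.TensorProduct.basis_apply _ _
  have : (shapovalovPoly N n).flip (polyBasis N n I) = (polyBasis N n).coord I := by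
    refine (polyBasis N n).ext fun K => ?_
    change shapovalovPoly N n (polyBasis N n K) (polyBasis N n I) = _
    rw [Module.Basis.coord_apply, Module.Basis.repr_self,
      Finsupp.single_apply, hb, hb]
    refine (shapovalovPoly_pureV 1 1 _ _).trans ?_
    rw [shapovalov_tensorBasis, mul_one, ite_smul, one_smul, zero_smul]
  exact LinearMap.congr_fun this x

/-! ### Twisted sums for the characters `1` and `sgn` -/

theorem permAct_mul {N n : ℕ} (σ τ : Equiv.Perm (Fin n)) (x : PolyV N n) :
    permAct N n (σ * τ) x = permAct N n σ (permAct N n τ x) := by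
  have h : permAct N n (σ * τ) = permAct N n σ ∘ₗ permAct N n τ := by
    refine Eq.trans ?_ (TensorProduct.map_comp _ _ _ _)
    refine congrArg₂ TensorProduct.map (LinearMap.ext fun p => ?_) ?_
    · exact (rename_rename τ σ p).symm
    · refine (tensorBasis N n).ext fun I => ?_
      simp only [LinearMap.comp_apply, LinearEquiv.coe_coe, reindex_tensorBasis]
      rfl
  exact LinearMap.congr_fun h x

/-- The twisted sum `∑ χ(σ) σ(x)` for a sign character `χ` of the symmetric group. -/
def twistedSum (N n : ℕ) (χ : Equiv.Perm (Fin n) →* ℤˣ) : PolyV N n →ₗ[SymPoly n] PolyV N n where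
  toFun x := ∑ σ, ((χ σ : ℤ) : ℂ) • permAct N n σ x
  map_add' x y := by simp only [map_add, smul_add, Finset.sum_add_distrib]
  map_smul' p x := by
    simp only [permAct_smul, Finset.smul_sum, RingHom.id_apply]
    exact Finset.sum_congr rfl fun σ _ => (smul_algebra_smul_comm _ _ _).symm

/-- The elements on which the symmetric group acts through the sign character `χ`. -/
def IsTwisted {N n : ℕ} (χ : Equiv.Perm (Fin n) →* ℤˣ) (x : PolyV N n) : Prop :=
  ∀ σ, permAct N n σ x = ((χ σ : ℤ) : ℂ) • x

theorem isTwisted_twistedSum {N n : ℕ} (χ : Equiv.Perm (Fin n) →* ℤˣ) (x : PolyV N n) :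
    IsTwisted χ (twistedSum N n χ x) := by
  intro τ
  change permAct N n τ (∑ σ, _) = _ • ∑ σ, _
  rw [map_sum, Finset.smul_sum]
  refine Fintype.sum_equiv (Equiv.mulLeft τ) _ _ fun σ => ?_
  rw [Equiv.coe_mulLeft, map_mul, Units.val_mul, Int.cast_mul, mul_smul, units_smul_units_smul,
    map_smul, permAct_mul]

theorem IsTwisted.twistedSum_eq {N n : ℕ} {χ : Equiv.Perm (Fin n) →* ℤˣ} {x : PolyV N n}
    (hx : IsTwisted χ x) : twistedSum N n χ x = (n.factorial : SymPoly n) • x := by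
  change ∑ σ, _ = _
  simp only [hx _, units_smul_units_smul]
  rw [Finset.sum_const, Finset.card_univ, Fintype.card_perm, Fintype.card_fin,
    Nat.cast_smul_eq_nsmul]

theorem IsTwisted.shapovalovPoly_isAlternatingPoly {N n : ℕ} {χ ψ : Equiv.Perm (Fin n) →* ℤˣ}
    (hχψ : χ * ψ = Equiv.Perm.sign) {x y : PolyV N n} (hx : IsTwisted χ x) (hy : IsTwisted ψ y) :
    IsAlternatingPoly (shapovalovPoly N n x y) := by
  intro σ
  rw [← shapovalovPoly_permAct, hx, hy, ← hχψ, shapovalovPoly_smul_left,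
    shapovalovPoly_smul_right, smul_smul, MonoidHom.mul_apply, Units.val_mul, Int.cast_mul]

/-- By equivariance, `ψ(σ) ⟨x, σy⟩ = ψ(σ) χ(σ) ⟨σx, σy⟩ = sgn(σ) σ⟨x, y⟩`. -/
theorem IsTwisted.shapovalovPoly_twistedSum {N n : ℕ} {χ ψ : Equiv.Perm (Fin n) →* ℤˣ}
    (hχψ : χ * ψ = Equiv.Perm.sign) {x : PolyV N n} (hx : IsTwisted χ x) (y : PolyV N n) :
    shapovalovPoly N n x (twistedSum N n ψ y) = antisymm n (shapovalovPoly N n x y) := by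
  change shapovalovPoly N n x (∑ σ, _) = _
  rw [map_sum, antisymm_apply]
  refine Finset.sum_congr rfl fun σ _ => ?_
  rw [← shapovalovPoly_permAct, hx, ← hχψ, shapovalovPoly_smul_left,
    shapovalovPoly_smul_right, MonoidHom.mul_apply, mul_comm, Units.val_mul, Int.cast_mul,
    mul_smul, units_smul_units_smul]

/-- An element of type `χ` orthogonal modulo `J` to all elements of the complementary type is
the twisted sum of an element of `J 𝒱`. -/
theorem IsTwisted.exists_mem_idealJ_smul_top {N n : ℕ} {χ ψ : Equiv.Perm (Fin n) →* ℤˣ}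
    (hχψ : χ * ψ = Equiv.Perm.sign) {x : PolyV N n} (hx : IsTwisted χ x)
    (h : ∀ y, ∃ s ∈ idealJ n, shapovalovPoly N n x (twistedSum N n ψ y) =
      vandermondePoly n * algebraMap (SymPoly n) (Poly n) s) :
    ∃ w ∈ idealJ n • (⊤ : Submodule (SymPoly n) (PolyV N n)), x = twistedSum N n χ w := by
  have hmem : x ∈ idealJ n • (⊤ : Submodule (SymPoly n) (PolyV N n)) := by
    rw [← (polyBasis N n).sum_repr x]
    refine Submodule.sum_mem _ fun I _ => ?_
    have hI : (polyBasis N n).repr x I ∈ idealJ n • (⊤ : Submodule (SymPoly n) (Poly n)) := by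
      refine mem_idealJ_smul_top fun g => ?_
      obtain ⟨s, hs, hs'⟩ := h (g • polyBasis N n I)
      refine ⟨s, hs, ?_⟩
      rw [← hs', hx.shapovalovPoly_twistedSum hχψ, map_smul, shapovalovPoly_polyBasis, smul_eq_mul,
        mul_comm]
    -- The map `g ↦ g e_I` is `ℂ[z]⁺`-linear, so it carries `J ℂ[z]` into `J 𝒱`.
    exact Submodule.smul_mono le_rfl le_top (Submodule.map_smul'' (idealJ n) ⊤
      ((LinearMap.toSpanSingleton (Poly n) (PolyV N n) (polyBasis N n I)).restrictScalars
        (SymPoly n)) ▸ Submodule.mem_map_of_mem hI)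
  have hunit : algebraMap ℂ (SymPoly n) (n.factorial : ℂ)⁻¹ * (n.factorial : SymPoly n) = 1 := by
    rw [← map_natCast (algebraMap ℂ (SymPoly n)), ← map_mul,
      inv_mul_cancel₀ (Nat.cast_ne_zero.mpr n.factorial_ne_zero), map_one]
  -- The twisted sum multiplies `x` by `n!`, so `w = x / n!` has twisted sum `x`.
  refine ⟨algebraMap ℂ (SymPoly n) (n.factorial : ℂ)⁻¹ • x, Submodule.smul_mem _ _ hmem, ?_⟩
  rw [map_smul, hx.twistedSum_eq, smul_smul, hunit, one_smul]

/-! ### The pairing `𝒮₊₋` -/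

/-- Symmetrization, as a map onto the invariants. -/
def symmetrizer (N n : ℕ) : PolyV N n →ₗ[SymPoly n] invariants N n :=
  (twistedSum N n 1).codRestrict _ fun x σ => by
    simpa using isTwisted_twistedSum 1 x σ

/-- Division of antiinvariants by `D`. -/
def divVandermonde (N n : ℕ) : antiinvariants N n →ₗ[SymPoly n] divAntiinvariants N n where
  toFun x := ⟨(algebraMap (Poly n) (RatFun n) (vandermondePoly n))⁻¹ • toRatV N n x, x, x.2, rfl⟩
  map_add' x y := Subtype.ext (by simp only [Submodule.coe_add, map_add, smul_add])
  map_smul' p x := Subtype.ext (by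
    change _ • toRatV N n (p • (x : PolyV N n)) = p • (_ • toRatV N n x)
    rw [toRatV_smul, smul_algebra_smul_comm])

theorem divVandermonde_surjective (N n : ℕ) : Function.Surjective (divVandermonde N n) := by
  rintro ⟨_, x, hx, rfl⟩
  exact ⟨⟨x, hx⟩, rfl⟩

/-- Antisymmetrization, as a map onto the antiinvariants. -/
def antisymmetrizer (N n : ℕ) : PolyV N n →ₗ[SymPoly n] antiinvariants N n :=
  (twistedSum N n Equiv.Perm.sign).codRestrict _ (isTwisted_twistedSum Equiv.Perm.sign)

theorem isTwisted_one_of_mem {N n : ℕ} (x : invariants N n) :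
    IsTwisted 1 (x : PolyV N n) := fun σ => by
  simpa using x.2 σ

/-- Makes the symmetric value of the form unique, so its bilinearity can be checked in `ℂ(z)`. -/
theorem algebraMap_symPoly_ratFun_injective (n : ℕ) :
    Function.Injective (algebraMap (SymPoly n) (RatFun n)) := by
  rw [IsScalarTower.algebraMap_eq (SymPoly n) (Poly n) (RatFun n)]
  exact (IsFractionRing.injective (Poly n) (RatFun n)).comp Subtype.val_injective

theorem shapovalovRat_divVandermonde {N n : ℕ} (x : PolyV N n) (y : antiinvariants N n) :
    shapovalovRat N n (toRatV N n x) (divVandermonde N n y) =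
      (algebraMap (Poly n) (RatFun n) (vandermondePoly n))⁻¹ *
        algebraMap (Poly n) (RatFun n) (shapovalovPoly N n x y) := by
  rw [← shapovalovRat_toRatV, ← smul_eq_mul, ← map_smul]
  rfl

theorem algebraMap_eq_shapovalovRat_iff {N n : ℕ} (x : PolyV N n) (y : antiinvariants N n)
    (s : SymPoly n) : algebraMap (SymPoly n) (RatFun n) s =
      shapovalovRat N n (toRatV N n x) (divVandermonde N n y) ↔
    shapovalovPoly N n x y = vandermondePoly n * algebraMap (SymPoly n) (Poly n) s := by
  have hD : algebraMap (Poly n) (RatFun n) (vandermondePoly n) ≠ 0 :=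
    (map_ne_zero_iff _ (IsFractionRing.injective _ _)).mpr (vandermondePoly_ne_zero n)
  rw [shapovalovRat_divVandermonde, eq_inv_mul_iff_mul_eq₀ hD,
    IsScalarTower.algebraMap_apply (SymPoly n) (Poly n) (RatFun n), ← map_mul,
    (IsFractionRing.injective (Poly n) (RatFun n)).eq_iff, eq_comm]

theorem exists_symPoly_eq_shapovalovRat {N n : ℕ} (x : invariants N n)
    (y : divAntiinvariants N n) : ∃ s : SymPoly n,
      algebraMap (SymPoly n) (RatFun n) s = shapovalovRat N n (toRatV N n x) y := by
  obtain ⟨y, rfl⟩ := divVandermonde_surjective N n y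
  obtain ⟨s, hs⟩ := ((isTwisted_one_of_mem x).shapovalovPoly_isAlternatingPoly
    (one_mul _) y.2).exists_symPoly
  exact ⟨s, (algebraMap_eq_shapovalovRat_iff _ _ _).mpr hs⟩

/-- The value of the Shapovalov form on `𝒱⁺ × (1/D) 𝒱⁻`, as a symmetric polynomial. -/
def symValue {N n : ℕ} (x : invariants N n) (y : divAntiinvariants N n) : SymPoly n :=
  (exists_symPoly_eq_shapovalovRat x y).choose

theorem algebraMap_symValue {N n : ℕ} (x : invariants N n) (y : divAntiinvariants N n) :
    algebraMap (SymPoly n) (RatFun n) (symValue x y) =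
      shapovalovRat N n (toRatV N n x) y :=
  (exists_symPoly_eq_shapovalovRat x y).choose_spec

/-- The pairing `𝒮₊₋` of `𝒱⁺` and `(1/D) 𝒱⁻` with values in `ℂ[z]⁺`. -/
def symPairing (N n : ℕ) :
    invariants N n →ₗ[SymPoly n] divAntiinvariants N n →ₗ[SymPoly n] SymPoly n :=
  LinearMap.mk₂ (SymPoly n) symValue
    (fun x x' y => algebraMap_symPoly_ratFun_injective n (by
      simp only [map_add, algebraMap_symValue, Submodule.coe_add, LinearMap.add_apply]))
    (fun c x y => algebraMap_symPoly_ratFun_injective n (by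
      simp only [smul_eq_mul, map_mul, algebraMap_symValue, Submodule.coe_smul, toRatV_smul]
      rw [← algebraMap_smul (RatFun n), map_smul, LinearMap.smul_apply, smul_eq_mul]))
    (fun x y y' => algebraMap_symPoly_ratFun_injective n (by
      simp only [map_add, algebraMap_symValue, Submodule.coe_add]))
    (fun c x y => algebraMap_symPoly_ratFun_injective n (by
      simp only [smul_eq_mul, map_mul, algebraMap_symValue, Submodule.coe_smul]
      rw [← algebraMap_smul (RatFun n), map_smul, smul_eq_mul]))

theorem algebraMap_symPairing {N n : ℕ} (x : invariants N n) (y : divAntiinvariants N n) :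
    algebraMap (SymPoly n) (RatFun n) (symPairing N n x y) =
      shapovalovRat N n (toRatV N n x) y :=
  algebraMap_symValue x y

theorem shapovalovPoly_eq_mul_symPairing {N n : ℕ} (x : invariants N n)
    (y : antiinvariants N n) : shapovalovPoly N n x y =
      vandermondePoly n * algebraMap (SymPoly n) (Poly n)
        (symPairing N n x (divVandermonde N n y)) :=
  (algebraMap_eq_shapovalovRat_iff _ _ _).mp (algebraMap_symPairing _ _)

/-! ### Nondegeneracy and reduction modulo `J` -/

theorem mem_Jplus_of_symPairing_mem {N n : ℕ} (x : invariants N n)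
    (h : ∀ y, symPairing N n x y ∈ idealJ n) : x ∈ Jplus N n := by
  obtain ⟨w, hw, hxw⟩ := (isTwisted_one_of_mem x).exists_mem_idealJ_smul_top (one_mul _)
    fun y => ⟨_, h _, shapovalovPoly_eq_mul_symPairing x (antisymmetrizer N n y)⟩
  have hx : x = symmetrizer N n w := Subtype.ext hxw
  rw [hx]
  -- Symmetrization is `ℂ[z]⁺`-linear with invariant values, so it maps `J 𝒱` into `J 𝒱⁺`.
  exact Submodule.smul_mono le_rfl le_top
    (Submodule.map_smul'' (idealJ n) ⊤ (symmetrizer N n) ▸ Submodule.mem_map_of_mem hw)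

theorem mem_Jminus_of_symPairing_mem {N n : ℕ} (y : divAntiinvariants N n)
    (h : ∀ x, symPairing N n x y ∈ idealJ n) : y ∈ Jminus N n := by
  obtain ⟨y, rfl⟩ := divVandermonde_surjective N n y
  have hy : IsTwisted Equiv.Perm.sign (y : PolyV N n) := y.2
  obtain ⟨w, hw, hyw⟩ := hy.exists_mem_idealJ_smul_top (mul_one _)
    fun x => ⟨_, h _, (shapovalovPoly_comm _ _).trans
      (shapovalovPoly_eq_mul_symPairing (symmetrizer N n x) y)⟩
  have hy' : y = antisymmetrizer N n w := Subtype.ext hyw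
  rw [hy', ← LinearMap.comp_apply]
  exact Submodule.smul_mono le_rfl le_top
    (Submodule.map_smul'' (idealJ n) ⊤ (divVandermonde N n ∘ₗ antisymmetrizer N n) ▸
      Submodule.mem_map_of_mem hw)

/-- A linear form on `M` sends `I M` into `I`. -/
theorem apply_mem_of_mem_smul_top {R M : Type*} [CommRing R] [AddCommGroup M] [Module R M]
    (f : M →ₗ[R] R) (I : Ideal R) {x : M} (hx : x ∈ I • (⊤ : Submodule R M)) : f x ∈ I := by
  have := Submodule.mem_map_of_mem (f := f) hx
  rw [Submodule.map_smul''] at this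
  exact (Submodule.smul_mono le_rfl le_top).trans (Ideal.mul_top I).le this

/-- The reduction of `𝒮₊₋` modulo `J`, with values in `ℂ[z]⁺ / J`. -/
def quotientPairing (N n : ℕ) : (invariants N n ⧸ Jplus N n) →ₗ[SymPoly n]
    (divAntiinvariants N n ⧸ Jminus N n) →ₗ[SymPoly n] (SymPoly n ⧸ idealJ n) :=
  (Jplus N n).liftQ
    (((Jminus N n).liftQ ((symPairing N n).compr₂ (idealJ n).mkQ).flip fun y hy => by
      ext x
      exact (Submodule.Quotient.mk_eq_zero _).mpr
        (apply_mem_of_mem_smul_top (symPairing N n x) _ hy)).flip) fun x hx => by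
    rw [LinearMap.mem_ker]
    ext y
    exact (Submodule.Quotient.mk_eq_zero _).mpr
      (apply_mem_of_mem_smul_top ((symPairing N n).flip y) _ hx)

theorem quotientPairing_mk {N n : ℕ} (x : invariants N n) (y : divAntiinvariants N n) :
    quotientPairing N n (Submodule.Quotient.mk x) (Submodule.Quotient.mk y) =
      Ideal.Quotient.mk (idealJ n) (symPairing N n x y) :=
  rfl

/-- The isomorphism `ℂ = ℂ[z]⁺ / J`. -/
def quotientEquiv (n : ℕ) : ℂ ≃ₗ[ℂ] SymPoly n ⧸ idealJ n :=
  LinearEquiv.ofBijective (Algebra.linearMap ℂ (SymPoly n ⧸ idealJ n))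
    (bijective_algebraMap_quotient_idealJ n)

/-- The `ℂ`-bilinear pairing of `𝒱⁺ / J⁺` and `(1/D) 𝒱⁻ / J⁻`. -/
def reducedPairing (N n : ℕ) : (invariants N n ⧸ Jplus N n) →ₗ[ℂ]
    (divAntiinvariants N n ⧸ Jminus N n) →ₗ[ℂ] ℂ :=
  LinearMap.mk₂ ℂ (fun a b => (quotientEquiv n).symm (quotientPairing N n a b))
    (fun a a' b => by rw [map_add, LinearMap.add_apply, map_add])
    (fun c a b => by
      rw [← algebraMap_smul (SymPoly n) c a, map_smul, LinearMap.smul_apply, algebraMap_smul,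
        map_smul])
    (fun a b b' => by rw [map_add, map_add])
    (fun c a b => by
      rw [← algebraMap_smul (SymPoly n) c b, map_smul, algebraMap_smul, map_smul])

theorem algebraMap_reducedPairing {N n : ℕ} (a : invariants N n ⧸ Jplus N n)
    (b : divAntiinvariants N n ⧸ Jminus N n) :
    algebraMap ℂ (SymPoly n ⧸ idealJ n) (reducedPairing N n a b) = quotientPairing N n a b :=
  (quotientEquiv n).apply_symm_apply _

theorem symPairing_mem_of_reducedPairing_eq_zero {N n : ℕ} {x : invariants N n}
    {y : divAntiinvariants N n}
    (h : reducedPairing N n (Submodule.Quotient.mk x) (Submodule.Quotient.mk y) = 0) :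
    symPairing N n x y ∈ idealJ n := by
  rw [← Ideal.Quotient.eq_zero_iff_mem, ← quotientPairing_mk, ← algebraMap_reducedPairing, h,
    map_zero]

theorem reducedPairing_nondegenerate (N n : ℕ) : (reducedPairing N n).Nondegenerate := by
  constructor
  · intro a h
    obtain ⟨x, rfl⟩ := Submodule.Quotient.mk_surjective _ a
    exact (Submodule.Quotient.mk_eq_zero _).mpr (mem_Jplus_of_symPairing_mem x fun _ =>
      symPairing_mem_of_reducedPairing_eq_zero (h _))
  · intro b h
    obtain ⟨y, rfl⟩ := Submodule.Quotient.mk_surjective _ b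
    exact (Submodule.Quotient.mk_eq_zero _).mpr (mem_Jminus_of_symPairing_mem y fun _ =>
      symPairing_mem_of_reducedPairing_eq_zero (h _))

end ShapovalovPairing

end

/-- The Shapovalov form takes values in `ℂ[z]⁺` on `𝒱⁺ × (1/D) 𝒱⁻`, so it is a
`ℂ[z]⁺`-bilinear map `S`; reducing `S` modulo `J` gives a `ℂ`-bilinear pairing `B` of
`𝒱⁺ / J⁺` and `(1/D) 𝒱⁻ / J⁻` with values in `ℂ = ℂ[z]⁺ / J`, and `B` is nondegenerate. -/
theorem theorem3p4 (N n : ℕ) :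
    ∃ S : invariants N n →ₗ[SymPoly n]
        divAntiinvariants N n →ₗ[SymPoly n]
          SymPoly n,
      (∀ (x : invariants N n) (y : divAntiinvariants N n),
        algebraMap (SymPoly n) (RatFun n) (S x y) =
          shapovalovRat N n (toRatV N n x) y) ∧
      ∃ B : (invariants N n ⧸ Jplus N n) →ₗ[ℂ]
          (divAntiinvariants N n ⧸ Jminus N n) →ₗ[ℂ] ℂ,
        (∀ (x : invariants N n)
          (y : divAntiinvariants N n),
          algebraMap ℂ (SymPoly n ⧸ idealJ n)
              (B (Submodule.Quotient.mk x) (Submodule.Quotient.mk y)) =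
            Ideal.Quotient.mk (idealJ n) (S x y)) ∧
        B.Nondegenerate := by
  exact ⟨symPairing N n, algebraMap_symPairing, reducedPairing N n,
    fun x y => (algebraMap_reducedPairing _ _).trans (quotientPairing_mk x y),
    reducedPairing_nondegenerate N n⟩
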